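/- Let $a, A, B, b$ be finite-dimensional quantum systems (complex Hilbert spaces of arbitrary finite dimensions). Let $H$ be a Hermitian operator on $A\otimes B$ with operator norm $\|H\|$, and let $|\Psi\rangle$ be a unit vector in $a\otimes A\otimes B\otimes b$. For $t\in\mathbb{R}$ put $$U(t)=I_a\otimes e^{iHt}\otimes I_b,\qquad \rho_{aA}(t)=\mathrm{Tr}_{Bb}\,U(t)|\Psi\rangle\langle\Psi|U(t)^\dagger,\qquad S(t)=-\mathrm{Tr}\,\rho_{aA}(t)\log\rho_{aA}(t),$$ where $\log$ is the logarithm to base two and $0\log 0=0$. Suppose that $|\Psi\rangle$ has at most two distinct nonzero Schmidt coefficients across the partition $aA\,|\,Bb$, of arbitrary multiplicities; that is, $|\Psi\rangle=\sum_{j=1}^{r}\sqrt{p_j}\,|u_j\rangle\otimes|v_j\rangle$ with orthonormal families $(u_j)$ in $a\otimes A$ and $(v_j)$ in $B\otimes b$ and $p_j>0$, where the set $\{p_1,\dots,p_r\}$ has at most two elements. Then $S$ is differentiable at $t=0$, and the entangling rate $\Gamma(\Psi,H)=\frac{dS}{dt}\big|_{t=0}$ satisfies $$\Gamma(\Psi,H)\le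 24\,\|H\|\,\log d,\qquad d=\min(\dim A,\dim B).$$ In particular, the bound does not depend on the dimensions of the ancillas $a$ and $b$. -/

import Mathlib

open scoped Matrix Kronecker

noncomputable section

namespace Entangling

variable {a A B b : Type*} [Fintype a] [Fintype A] [Fintype B] [Fintype b]
  [DecidableEq a] [DecidableEq A] [DecidableEq B] [DecidableEq b]

/-- The state space of the composite system `aABb`: the finite-dimensional Hilbert space
`ℂᵃ ⊗ (ℂᴬ ⊗ ℂᴮ) ⊗ ℂᵇ`, written in the product basis. -/
abbrev StateSpace (a A B b : Type*) : Type _ :=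
  EuclideanSpace ℂ (a × (A × B) × b)

/-- The operator norm of a matrix, as an operator on the Hilbert space `ℂⁿ`. -/
def opNorm {n : Type*} [Fintype n] [DecidableEq n] (H : Matrix n n ℂ) : ℝ :=
  ‖Matrix.toEuclideanCLM (n := n) (𝕜 := ℂ) H‖

/-- The evolution operator `U(t) = I_a ⊗ e^{iHt} ⊗ I_b`. -/
def evolution (a b : Type*) [DecidableEq a] [DecidableEq b]
    (H : Matrix (A × B) (A × B) ℂ) (t : ℝ) :
    Matrix (a × (A × B) × b) (a × (A × B) × b) ℂ :=
  (1 : Matrix a a ℂ) ⊗ₖ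
    (NormedSpace.exp ((Complex.I * (t : ℂ)) • H) ⊗ₖ (1 : Matrix b b ℂ))

/-- The rank-one operator `|Ψ⟩⟨Ψ|`. -/
def ketBra {n : Type*} (Ψ : EuclideanSpace ℂ n) : Matrix n n ℂ :=
  Matrix.of fun i j => Ψ i * star (Ψ j)

/-- The partial trace over `Bb` of an operator on `aABb`, an operator on `aA`. -/
def partialTraceBb (ρ : Matrix (a × (A × B) × b) (a × (A × B) × b) ℂ) :
    Matrix (a × A) (a × A) ℂ :=
  Matrix.of fun p q => ∑ y : B, ∑ k : b, ρ (p.1, (p.2, y), k) (q.1, (q.2, y), k)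

/-- The reduced density matrix `ρ_{aA}(t) = Tr_{Bb} U(t) |Ψ⟩⟨Ψ| U(t)†`. -/
def reducedState (Ψ : StateSpace a A B b) (H : Matrix (A × B) (A × B) ℂ) (t : ℝ) :
    Matrix (a × A) (a × A) ℂ :=
  partialTraceBb (evolution a b H t * ketBra Ψ * (evolution a b H t)ᴴ)

/-- The von Neumann entropy `-Tr ρ log ρ`, with the base two logarithm. The matrix `log ρ` is
given by the continuous functional calculus; as `Real.logb 2 0 = 0`, the kernel of `ρ`
contributes zero, which is the usual convention `0 log 0 = 0`. -/
def vonNeumannEntropy {n : Type*} [Fintype n] [DecidableEq n] (ρ : Matrix n n ℂ) : ℝ :=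
  -(Matrix.trace (ρ * cfc (Real.logb 2) ρ)).re

/-- The entanglement entropy `S(aA)` at time `t`. -/
def entanglementEntropy (Ψ : StateSpace a A B b) (H : Matrix (A × B) (A × B) ℂ) (t : ℝ) : ℝ :=
  vonNeumannEntropy (reducedState Ψ H t)

/-- The entangling rate `Γ(Ψ, H)`, the derivative of `S(aA)` at time zero. -/
def entanglingRate (Ψ : StateSpace a A B b) (H : Matrix (A × B) (A × B) ℂ) : ℝ :=
  deriv (entanglementEntropy Ψ H) 0

/-- `|Ψ⟩ = ∑ⱼ √pⱼ |uⱼ⟩ ⊗ |vⱼ⟩` is a Schmidt decomposition across `aA | Bb`: the families `u` in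
`aA` and `v` in `Bb` are orthonormal, and the Schmidt coefficients `pⱼ` are positive. -/
structure IsSchmidtDecomposition (Ψ : StateSpace a A B b) {r : ℕ} (p : Fin r → ℝ)
    (u : Fin r → EuclideanSpace ℂ (a × A)) (v : Fin r → EuclideanSpace ℂ (B × b)) : Prop where
  pos : ∀ j, 0 < p j
  left_orthonormal : Orthonormal ℂ u
  right_orthonormal : Orthonormal ℂ v
  decomposition : ∀ (i : a) (x : A) (y : B) (k : b),
    Ψ (i, (x, y), k) = ∑ j, (Real.sqrt (p j) : ℂ) * (u j (i, x) * v j (y, k))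

/-- `Ψ` has at most two distinct (nonzero) Schmidt coefficients across `aA | Bb`, of any
multiplicities. The coefficients do not depend on the choice of the decomposition. -/
def AtMostTwoSchmidtCoefficients (Ψ : StateSpace a A B b) : Prop :=
  ∃ (r : ℕ) (p : Fin r → ℝ) (u : Fin r → EuclideanSpace ℂ (a × A))
    (v : Fin r → EuclideanSpace ℂ (B × b)),
    IsSchmidtDecomposition Ψ p u v ∧ (Set.range p).ncard ≤ 2

end Entangling

end

/-!
Let `M(t)` be the matrix of coefficients of `U(t)Ψ` across `aA | Bb`, so that `ρ(t) = M(t) M(t)ᴴ`.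

*Derivative of the entropy.* Choose an orthonormal eigenbasis `e` of `ρ(0)` that contains the
Schmidt vectors `u j`. Then `Tr ρ log ρ` is the sum over `e i` of the mean of `x log x` in the
spectral distribution of `ρ(t)` in the state `e i` (`spectralMean`). If `e i` has eigenvalue
`l > 0`, then `x log x` lies between its tangent at `l` and the tangent plus `(x - l)² / l`, and the
mean of `(x - l)²` is `‖(ρ(t) - l) e i‖² = O(t²)`; so only the tangent contributes to the
derivative.
If `e i` lies in the kernel, the mean of `x` is `‖M(t)ᴴ e i‖² = O(t²)`, and the tangent at `t²`
from below and `x²` from above show that the mean of `x log x` is `O(t² log t)`. Thus the entropy is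
differentiable whether or not `ρ(0)` is invertible (`hasDerivAt_vonNeumannEntropy`).

*The rate for two Schmidt coefficients.* Let `P ≥ Q` be the two values of `p j`, and let
`Ψ = Ψ₁ + Ψ₂` be the corresponding splitting of the Schmidt decomposition. Since `⟨ψ, Hψ⟩` is real,
the derivative is `2 log (P / Q) Im ⟨Ψ₁, H Ψ₂⟩`
(`IsSchmidtDecomposition.hasDerivAt_of_two_values`).

*The bound.* Trivially `|⟨Ψ₁, H Ψ₂⟩| ≤ ‖H‖`. On the other hand, `H` is a sum of `d²` products of
operators of norm at most `‖H‖`, one for each pair of basis vectors of the smaller of `A` and `B`,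
and for a product `X ⊗ Y` Bessel's inequality gives
`|∑ k, ⟨u j, X u k⟩ ⟨v j, Y v k⟩| ≤ ‖X‖ ‖Y‖`. Summing over the at most `1 / P` indices `j` of `Ψ₁`
yields `|⟨Ψ₁, H Ψ₂⟩| ≤ d² ‖H‖ √(Q / P)`
(`IsSchmidtDecomposition.norm_inner_schmidtPart_le`). The first bound suffices for `P / Q ≤ d⁸`, and
the second beyond, where the square root beats the logarithm (`log_sub_log_mul_le`). For `d = 1` the
factor `log d` vanishes; there `H` acts on one side only, and `⟨Ψ₁, H Ψ₂⟩ = 0` by orthogonality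
(`inner_tensor_localOp_eq_zero`).
-/

noncomputable section

namespace Entangling

/-! ### Spectral distribution of a Hermitian matrix in a state -/

section Spectral

open scoped ComplexOrder

variable {m n ι : Type*} [Fintype m] [Fintype n] [Fintype ι] [DecidableEq m] [DecidableEq n]

/-- The mean of `f` in the spectral distribution of `σ` in the state `e`, that is
`⟨e, f(σ) e⟩`, written in an eigenbasis of `σ`. -/
def spectralMean {σ : Matrix m m ℂ} (hσ : σ.IsHermitian) (f : ℝ → ℝ)
    (e : EuclideanSpace ℂ m) : ℝ :=
  ∑ k, ‖inner ℂ (hσ.eigenvectorBasis k) e‖ ^ 2 * f (hσ.eigenvalues k)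

lemma inner_eigenvectorBasis_mulVec {σ : Matrix m m ℂ} (hσ : σ.IsHermitian)
    (e : EuclideanSpace ℂ m) (k : m) :
    inner ℂ (hσ.eigenvectorBasis k) (σ.toEuclideanLin e) =
      hσ.eigenvalues k * inner ℂ (hσ.eigenvectorBasis k) e := by
  have hsym : (σ.toEuclideanLin).IsSymmetric := Matrix.isSymmetric_toEuclideanLin_iff.2 hσ
  have hk : σ.toEuclideanLin (hσ.eigenvectorBasis k) =
      (hσ.eigenvalues k : ℂ) • hσ.eigenvectorBasis k := by
    ext i
    have := congrFun (hσ.mulVec_eigenvectorBasis k) i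
    simpa using this
  rw [← hsym, hk, inner_smul_left]
  simp

lemma spectralMean_const {σ : Matrix m m ℂ} (hσ : σ.IsHermitian) (c : ℝ)
    (e : EuclideanSpace ℂ m) : spectralMean hσ (fun _ => c) e = ‖e‖ ^ 2 * c := by
  rw [spectralMean, ← Finset.sum_mul, hσ.eigenvectorBasis.sum_sq_norm_inner_right]

lemma spectralMean_id {σ : Matrix m m ℂ} (hσ : σ.IsHermitian)
    (e : EuclideanSpace ℂ m) :
    spectralMean hσ (fun x => x) e = (inner ℂ e (σ.toEuclideanLin e)).re := by
  rw [← hσ.eigenvectorBasis.sum_inner_mul_inner e (σ.toEuclideanLin e), Complex.re_sum]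
  refine Finset.sum_congr rfl fun k _ => ?_
  rw [inner_eigenvectorBasis_mulVec, mul_left_comm, ← inner_conj_symm e, Complex.conj_mul',
    ← Complex.ofReal_pow, ← Complex.ofReal_mul, Complex.ofReal_re, mul_comm]

lemma spectralMean_sub_sq {σ : Matrix m m ℂ} (hσ : σ.IsHermitian) (c : ℝ)
    (e : EuclideanSpace ℂ m) :
    spectralMean hσ (fun x => (x - c) ^ 2) e = ‖σ.toEuclideanLin e - (c : ℂ) • e‖ ^ 2 := by
  rw [← hσ.eigenvectorBasis.sum_sq_norm_inner_right]
  refine Finset.sum_congr rfl fun k _ => ?_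
  rw [inner_sub_right, inner_eigenvectorBasis_mulVec, inner_smul_right, ← sub_mul, norm_mul,
    mul_pow, mul_comm, ← Complex.ofReal_sub, Complex.norm_real, Real.norm_eq_abs, sq_abs]

lemma spectralMean_affine {σ : Matrix m m ℂ} (hσ : σ.IsHermitian) (c d : ℝ)
    (e : EuclideanSpace ℂ m) :
    spectralMean hσ (fun x => c * x + d) e =
      c * (inner ℂ e (σ.toEuclideanLin e)).re + ‖e‖ ^ 2 * d := by
  rw [← spectralMean_id hσ, ← spectralMean_const hσ]
  simp only [spectralMean, Finset.mul_sum, ← Finset.sum_add_distrib]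
  exact Finset.sum_congr rfl fun k _ => by ring

lemma spectralMean_quadratic {σ : Matrix m m ℂ} (hσ : σ.IsHermitian) (c d k l : ℝ)
    (e : EuclideanSpace ℂ m) :
    spectralMean hσ (fun x => c * x + d + k * (x - l) ^ 2) e =
      c * (inner ℂ e (σ.toEuclideanLin e)).re + ‖e‖ ^ 2 * d +
        k * ‖σ.toEuclideanLin e - (l : ℂ) • e‖ ^ 2 := by
  rw [← spectralMean_affine hσ, ← spectralMean_sub_sq hσ]
  simp only [spectralMean, Finset.mul_sum, ← Finset.sum_add_distrib]
  exact Finset.sum_congr rfl fun k _ => by ring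

lemma spectralMean_mono {σ : Matrix m m ℂ} (hσ : σ.PosSemidef) {f g : ℝ → ℝ}
    (hfg : ∀ x, 0 ≤ x → f x ≤ g x) (e : EuclideanSpace ℂ m) :
    spectralMean hσ.1 f e ≤ spectralMean hσ.1 g e :=
  Finset.sum_le_sum fun k _ =>
    mul_le_mul_of_nonneg_left (hfg _ (hσ.eigenvalues_nonneg k)) (by positivity)

lemma trace_mul_cfc {σ : Matrix m m ℂ} (hσ : σ.IsHermitian) (f : ℝ → ℝ) :
    (σ * cfc f σ).trace = ∑ k, ((hσ.eigenvalues k * f (hσ.eigenvalues k) : ℝ) : ℂ) := by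
  have h : σ * cfc f σ = cfc (fun x => x * f x) σ := by
    have hfin : (spectrum ℝ σ).Finite := Matrix.finite_real_spectrum
    rw [cfc_mul (fun x => x) f σ (hfin.continuousOn _) (hfin.continuousOn _)]
    exact congrArg (· * cfc f σ) (cfc_id' ℝ σ hσ.isSelfAdjoint).symm
  rw [h, hσ.cfc_eq, Matrix.IsHermitian.cfc, Unitary.conjStarAlgAut_apply, Matrix.trace_mul_comm,
    ← mul_assoc]
  simp [Matrix.trace_diagonal]

/-- The entropy as a sum over an orthonormal basis that need not diagonalise `σ`; the basis can
therefore stay fixed while `σ` varies. -/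
lemma vonNeumannEntropy_eq_sum_spectralMean {σ : Matrix m m ℂ} (hσ : σ.IsHermitian)
    (e : OrthonormalBasis ι ℂ (EuclideanSpace ℂ m)) :
    vonNeumannEntropy σ =
      -(∑ i, spectralMean hσ (fun x => x * Real.log x) (e i)) / Real.log 2 := by
  rw [vonNeumannEntropy, trace_mul_cfc hσ, ← Complex.ofReal_sum, Complex.ofReal_re, neg_div,
    Finset.sum_div]
  congr 1
  simp only [spectralMean]
  simp_rw [Finset.sum_div]
  rw [Finset.sum_comm]
  refine Finset.sum_congr rfl fun k _ => ?_
  rw [← Finset.sum_div, ← Finset.sum_mul, e.sum_sq_norm_inner_left]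
  simp [Real.logb, mul_div_assoc]

/-! ### Bounds for `x log x` -/

lemma tangent_le_mul_log {l x : ℝ} (hl : 0 < l) (hx : 0 ≤ x) :
    (1 + Real.log l) * x + -l ≤ x * Real.log x := by
  rcases hx.eq_or_lt with rfl | hx
  · simpa using hl.le
  have h := Real.log_le_sub_one_of_pos (div_pos hl hx)
  rw [Real.log_div hl.ne' hx.ne'] at h
  have h2 := mul_le_mul_of_nonneg_left h hx.le
  have : x * (l / x - 1) = l - x := by field_simp
  rw [this] at h2
  nlinarith

lemma mul_log_le_tangent_add_sq {l x : ℝ} (hl : 0 < l) (hx : 0 ≤ x) :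
    x * Real.log x ≤ (1 + Real.log l) * x + -l + l⁻¹ * (x - l) ^ 2 := by
  rcases hx.eq_or_lt with rfl | hx
  · simp; field_simp; simp
  have h := Real.log_le_sub_one_of_pos (div_pos hx hl)
  rw [Real.log_div hx.ne' hl.ne'] at h
  have h2 := mul_le_mul_of_nonneg_left h hx.le
  have : x * (x / l - 1) = x - l + l⁻¹ * (x - l) ^ 2 := by field_simp; ring
  rw [this] at h2
  linarith

/-- The form `(x - 0) ^ 2` is that of `spectralMean_sub_sq` at the eigenvalue zero. -/
lemma mul_log_le_sq {x : ℝ} (hx : 0 ≤ x) : x * Real.log x ≤ (x - 0) ^ 2 := by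
  rcases hx.eq_or_lt with rfl | hx
  · simp
  have h := Real.log_le_sub_one_of_pos hx
  nlinarith

/-! ### Differentiability of the entropy -/

lemma hasDerivAt_zero_of_abs_le {f h : ℝ → ℝ} (hh : HasDerivAt h 0 0) (h0 : h 0 = 0)
    (hfh : ∀ t, |f t| ≤ h t) : HasDerivAt f 0 0 := by
  have hf0 : f 0 = 0 := by simpa [h0] using hfh 0
  rw [hasDerivAt_iff_isLittleO] at hh ⊢
  simp only [h0, hf0, sub_zero, smul_zero] at hh ⊢
  refine (Asymptotics.IsBigO.of_bound 1 (Filter.Eventually.of_forall fun t => ?_)).trans_isLittleO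
    hh
  simpa using (hfh t).trans (le_abs_self _)

lemma hasDerivAt_norm_sq_zero {E : Type*} [NormedAddCommGroup E] [InnerProductSpace ℂ E]
    {v : ℝ → E} {v' : E} (hv : HasDerivAt v v' 0) (h0 : v 0 = 0) :
    HasDerivAt (fun t => ‖v t‖ ^ 2) 0 0 := by
  let := InnerProductSpace.rclikeToReal ℂ E
  simpa [h0] using hv.norm_sq

lemma hasDerivAt_norm_sq_mul_log_zero {E : Type*} [NormedAddCommGroup E] [InnerProductSpace ℂ E]
    {v : ℝ → E} {v' : E} (hv : HasDerivAt v v' 0) (h0 : v 0 = 0) :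
    HasDerivAt (fun t => ‖v t‖ ^ 2 * (1 + |Real.log (t ^ 2)|)) 0 0 := by
  have hO : v =O[nhds 0] fun t : ℝ => t := by
    simpa [h0] using hv.isBigO_sub
  have h1 : (fun t => ‖v t‖ ^ 2) =O[nhds 0] fun t : ℝ => t ^ 2 := hO.norm_left.pow 2
  have h2 : (fun t : ℝ => t * (1 + |Real.log (t ^ 2)|)) =o[nhds 0] fun _ : ℝ => (1 : ℝ) := by
    rw [Asymptotics.isLittleO_one_iff]
    have hc : Continuous fun t : ℝ => |t| + 2 * |t * Real.log t| := by
      have := Real.continuous_mul_log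
      fun_prop
    have := hc.tendsto 0
    refine squeeze_zero_norm (fun t => le_of_eq ?_) (by simpa using this)
    rw [Real.log_pow, norm_mul, Real.norm_eq_abs, Real.norm_of_nonneg (by positivity),
      abs_mul, Nat.cast_ofNat, abs_two]
    ring
  rw [hasDerivAt_iff_isLittleO]
  have h3 := (h1.mul
    (Asymptotics.isBigO_refl (fun t : ℝ => 1 + |Real.log (t ^ 2)|) _)).trans_isLittleO (((Asymptotics.isBigO_refl (fun t : ℝ => t) _).mul_isLittleO h2).congr_left
      fun t => show _ = t ^ 2 * (1 + |Real.log (t ^ 2)|) by ring)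
  simpa [h0] using h3

omit [DecidableEq m] in
lemma hasDerivAt_toEuclideanLin {N : ℝ → Matrix m n ℂ} {N' : Matrix m n ℂ}
    (hN : ∀ i j, HasDerivAt (fun t => N t i j) (N' i j) 0)
    {v : ℝ → EuclideanSpace ℂ n} {v' : EuclideanSpace ℂ n} (hv : HasDerivAt v v' 0) :
    HasDerivAt (fun t => (N t).toEuclideanLin (v t))
      (N'.toEuclideanLin (v 0) + (N 0).toEuclideanLin v') 0 := by
  have hv' : ∀ j, HasDerivAt (fun t => v t j) (v' j) 0 := fun j =>
    ((EuclideanSpace.proj (𝕜 := ℂ) j).restrictScalars ℝ).hasFDerivAt.comp_hasDerivAt (0 : ℝ) hv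
  have h : HasDerivAt (fun t i => ∑ j, N t i j * v t j)
      (fun i => ∑ j, (N' i j * v 0 j + N 0 i j * v' j)) 0 :=
    hasDerivAt_pi.2 fun i => HasDerivAt.fun_sum fun j _ => (hN i j).mul (hv' j)
  have h2 := (((PiLp.continuousLinearEquiv 2 ℂ fun _ : m => ℂ).symm :
    (m → ℂ) →L[ℂ] PiLp 2 fun _ : m => ℂ).restrictScalars ℝ).hasFDerivAt.comp_hasDerivAt (0 : ℝ) h
  refine h2.congr_deriv ?_
  ext i
  simp [Matrix.mulVec, dotProduct, Finset.sum_add_distrib]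

section Path

variable {M : ℝ → Matrix m n ℂ} {M' : Matrix m n ℂ}

lemma toEuclideanLin_mul_conjTranspose (N : Matrix m n ℂ) (e : EuclideanSpace ℂ m) :
    (N * Nᴴ).toEuclideanLin e = N.toEuclideanLin (Nᴴ.toEuclideanLin e) := by
  ext i
  simp [Matrix.mulVec_mulVec]

lemma inner_mul_conjTranspose (N : Matrix m n ℂ) (e : EuclideanSpace ℂ m) :
    (inner ℂ e ((N * Nᴴ).toEuclideanLin e)).re = ‖Nᴴ.toEuclideanLin e‖ ^ 2 := by
  rw [toEuclideanLin_mul_conjTranspose, ← @inner_self_eq_norm_sq ℂ,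
    Matrix.toEuclideanLin_conjTranspose_eq_adjoint, LinearMap.adjoint_inner_left]
  rfl

omit [DecidableEq n] in
lemma hasDerivAt_conjTranspose_apply
    (hM : ∀ i j, HasDerivAt (fun t => M t i j) (M' i j) 0) (e : EuclideanSpace ℂ m) :
    HasDerivAt (fun t => (M t)ᴴ.toEuclideanLin e) (M'ᴴ.toEuclideanLin e) 0 := by
  have := hasDerivAt_toEuclideanLin (N := fun t => (M t)ᴴ) (N' := M'ᴴ)
    (fun i j => (hM j i).star) (hasDerivAt_const (0 : ℝ) e)
  simpa using this

/-- An eigenvector of `ρ(0)` with a positive eigenvalue `l` contributes the slope of `x log x` at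
`l` times the derivative of `⟨e, ρ(t) e⟩ = ‖M(t)ᴴ e‖²`. -/
lemma hasDerivAt_spectralMean_of_pos
    (hM : ∀ i j, HasDerivAt (fun t => M t i j) (M' i j) 0)
    {e : EuclideanSpace ℂ m} (he : ‖e‖ = 1) {l : ℝ} (hl : 0 < l)
    (hel : (M 0 * (M 0)ᴴ).toEuclideanLin e = (l : ℂ) • e) :
    HasDerivAt
      (fun t => spectralMean (Matrix.isHermitian_mul_conjTranspose_self (M t))
        (fun x => x * Real.log x) e)
      ((1 + Real.log l) *
        (2 * (inner ℂ ((M 0)ᴴ.toEuclideanLin e) (M'ᴴ.toEuclideanLin e)).re)) 0 := by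
  have hv := hasDerivAt_conjTranspose_apply hM e
  have hσe := hasDerivAt_toEuclideanLin hM hv
  have hq : HasDerivAt (fun t => ‖(M t)ᴴ.toEuclideanLin e‖ ^ 2)
      (2 * (inner ℂ ((M 0)ᴴ.toEuclideanLin e) (M'ᴴ.toEuclideanLin e)).re) 0 := by
    let := InnerProductSpace.rclikeToReal ℂ (EuclideanSpace ℂ n)
    exact hv.norm_sq
  have hpsd := fun t => Matrix.posSemidef_self_mul_conjTranspose (M t)
  have hlow := fun t => spectralMean_mono (hpsd t) (fun x hx => tangent_le_mul_log hl hx) e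
  have hupp := fun t => spectralMean_mono (hpsd t) (fun x hx => mul_log_le_tangent_add_sq hl hx) e
  simp only [spectralMean_affine, spectralMean_quadratic, inner_mul_conjTranspose, he] at hlow hupp
  have hrem : HasDerivAt (fun t => spectralMean (Matrix.isHermitian_mul_conjTranspose_self (M t))
      (fun x => x * Real.log x) e -
        ((1 + Real.log l) * ‖(M t)ᴴ.toEuclideanLin e‖ ^ 2 + -l)) 0 0 := by
    refine hasDerivAt_zero_of_abs_le
      (h := fun t => l⁻¹ * ‖(M t * (M t)ᴴ).toEuclideanLin e - (l : ℂ) • e‖ ^ 2) ?_ ?_ ?_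
    · simp only [toEuclideanLin_mul_conjTranspose] at hel ⊢
      simpa using (hasDerivAt_norm_sq_zero (hσe.sub_const ((l : ℂ) • e))
        (by rw [hel, sub_self])).const_mul l⁻¹
    · simp only [hel, sub_self]
      simp
    · intro t
      rw [abs_le]
      constructor <;> nlinarith [hlow t, hupp t]
  simpa using hrem.fun_add ((hq.const_mul (1 + Real.log l)).add_const (-l))

/-- A vector in the kernel of `ρ(0)` contributes nothing to first order, although `x log x` has an
infinite slope at zero. -/
lemma hasDerivAt_spectralMean_of_ker
    (hM : ∀ i j, HasDerivAt (fun t => M t i j) (M' i j) 0)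
    {e : EuclideanSpace ℂ m} (he : ‖e‖ = 1) (hel : (M 0)ᴴ.toEuclideanLin e = 0) :
    HasDerivAt
      (fun t => spectralMean (Matrix.isHermitian_mul_conjTranspose_self (M t))
        (fun x => x * Real.log x) e) 0 0 := by
  have hv := hasDerivAt_conjTranspose_apply hM e
  have hσe := hasDerivAt_toEuclideanLin hM hv
  have hpsd := fun t => Matrix.posSemidef_self_mul_conjTranspose (M t)
  have hupp := fun t => spectralMean_mono (hpsd t) (fun x hx => mul_log_le_sq hx) e
  -- The point of tangency `t ^ 2` makes both terms of the tangent `O(t ^ 2 * log t)`.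
  have hlow : ∀ t : ℝ, t ≠ 0 → _ := fun t ht => spectralMean_mono (hpsd t)
    (fun x hx => tangent_le_mul_log (l := t ^ 2) (by positivity) hx) e
  simp only [spectralMean_affine, spectralMean_sub_sq, inner_mul_conjTranspose, he] at hlow hupp
  refine hasDerivAt_zero_of_abs_le
    (h := fun t => ‖(M t * (M t)ᴴ).toEuclideanLin e‖ ^ 2 +
      (‖(M t)ᴴ.toEuclideanLin e‖ ^ 2 * (1 + |Real.log (t ^ 2)|) + t ^ 2)) ?_ ?_ ?_
  · have h1 := hasDerivAt_norm_sq_mul_log_zero hv hel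
    have h2 := hasDerivAt_norm_sq_zero hσe (by simp [hel])
    simp only [toEuclideanLin_mul_conjTranspose]
    simpa using h2.fun_add (h1.fun_add (hasDerivAt_pow 2 (0 : ℝ)))
  · simp [hel]
  · intro t
    have hu := hupp t
    simp only [Complex.ofReal_zero, zero_smul, sub_zero] at hu
    have h0 : 0 ≤ ‖(M t)ᴴ.toEuclideanLin e‖ ^ 2 := by positivity
    rw [abs_le]
    constructor
    · rcases eq_or_ne t 0 with rfl | ht
      · have : spectralMean (Matrix.isHermitian_mul_conjTranspose_self (M 0))
            (fun x => x * Real.log x) e = 0 := by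
          refine Finset.sum_eq_zero fun k _ => ?_
          have hk := inner_eigenvectorBasis_mulVec
            (Matrix.isHermitian_mul_conjTranspose_self (M 0)) e k
          rw [toEuclideanLin_mul_conjTranspose, hel, map_zero, inner_zero_right, eq_comm,
            mul_eq_zero] at hk
          rcases hk with hk | hk
          · simp [Complex.ofReal_eq_zero.1 hk]
          · simp [hk]
        rw [this]
        simp only [neg_nonpos]
        positivity
      · have hl := hlow t ht
        have hab := neg_abs_le (Real.log (t ^ 2))
        have : 0 ≤ ‖(M t * (M t)ᴴ).toEuclideanLin e‖ ^ 2 := by positivity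
        nlinarith [mul_le_mul_of_nonneg_left hab h0]
    · have : 0 ≤ ‖(M t)ᴴ.toEuclideanLin e‖ ^ 2 * (1 + |Real.log (t ^ 2)|) := by positivity
      nlinarith [sq_nonneg t]

/-- The derivative of the entropy of `ρ(t) = M(t) M(t)ᴴ`, for any `ρ(0)`. At a zero eigenvalue
`l i = 0` the summand vanishes because `M(0)ᴴ e i = 0`, so that the junk value of `log 0` plays no
role. -/
theorem hasDerivAt_vonNeumannEntropy
    (hM : ∀ i j, HasDerivAt (fun t => M t i j) (M' i j) 0)
    (e : OrthonormalBasis ι ℂ (EuclideanSpace ℂ m)) (l : ι → ℝ) (hl : ∀ i, 0 ≤ l i)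
    (hel : ∀ i, (M 0 * (M 0)ᴴ).toEuclideanLin (e i) = (l i : ℂ) • e i) :
    HasDerivAt (fun t => vonNeumannEntropy (M t * (M t)ᴴ))
      (-(∑ i, (1 + Real.log (l i)) * (2 * (inner ℂ ((M 0)ᴴ.toEuclideanLin (e i))
        (M'ᴴ.toEuclideanLin (e i))).re)) / Real.log 2) 0 := by
  simp_rw [fun t => vonNeumannEntropy_eq_sum_spectralMean
    (Matrix.isHermitian_mul_conjTranspose_self (M t)) e]
  refine (HasDerivAt.fun_sum fun i _ => ?_).neg.div_const _
  rcases (hl i).eq_or_lt with h | h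
  · have hk : (M 0)ᴴ.toEuclideanLin (e i) = 0 := by
      rw [← norm_eq_zero, ← sq_eq_zero_iff, ← inner_mul_conjTranspose, hel, ← h]
      simp
    simpa [hk] using hasDerivAt_spectralMean_of_ker hM (e.orthonormal.1 i) hk
  · exact hasDerivAt_spectralMean_of_pos hM (e.orthonormal.1 i) h (hel i)

end Path

end Spectral

variable {a A B b : Type*} [Fintype a] [Fintype A] [Fintype B] [Fintype b]
  [DecidableEq a] [DecidableEq A] [DecidableEq B] [DecidableEq b]

/-! ### Splitting a bipartite operator into products -/

/-- The operator `1 ⊗ H ⊗ 1` on the state space of `aABb`. -/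
def localOp (a b : Type*) [Fintype a] [Fintype b] [DecidableEq a] [DecidableEq b]
    (H : Matrix (A × B) (A × B) ℂ) : StateSpace a A B b →ₗ[ℂ] StateSpace a A B b :=
  ((1 : Matrix a a ℂ) ⊗ₖ (H ⊗ₖ (1 : Matrix b b ℂ))).toEuclideanLin

lemma localOp_apply (H : Matrix (A × B) (A × B) ℂ) (ψ : StateSpace a A B b)
    (i : a) (z : A × B) (k : b) :
    localOp a b H ψ (i, z, k) = ∑ z', H z z' * ψ (i, z', k) := by
  rw [localOp, Matrix.toLpLin_apply]
  simp only [Matrix.mulVec, dotProduct, Matrix.kroneckerMap_apply, Matrix.one_apply]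
  rw [Fintype.sum_prod_type, Finset.sum_eq_single i (fun i' _ h => by simp [h.symm]) (by simp),
    Fintype.sum_prod_type]
  refine Finset.sum_congr rfl fun z' _ => ?_
  rw [Finset.sum_eq_single k (fun k' _ h => by simp [h.symm]) (by simp)]
  simp

lemma localOp_isSymmetric {H : Matrix (A × B) (A × B) ℂ} (hH : H.IsHermitian) :
    (localOp a b H).IsSymmetric := by
  refine Matrix.isSymmetric_toEuclideanLin_iff.2 ?_
  rw [Matrix.IsHermitian, Matrix.conjTranspose_kronecker, Matrix.conjTranspose_kronecker, hH]
  simp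

omit [Fintype a] [Fintype b] [DecidableEq a] [DecidableEq b] in
lemma sum_norm_sq_mulVec_le (H : Matrix (A × B) (A × B) ℂ) (φ : A × B → ℂ) :
    ∑ z, ‖∑ z', H z z' * φ z'‖ ^ 2 ≤ opNorm H ^ 2 * ∑ z, ‖φ z‖ ^ 2 := by
  have h := (Matrix.toEuclideanCLM (n := A × B) (𝕜 := ℂ) H).le_opNorm (WithLp.toLp 2 φ)
  have h2 := pow_le_pow_left₀ (norm_nonneg _) h 2
  rw [mul_pow, EuclideanSpace.norm_sq_eq, EuclideanSpace.norm_sq_eq] at h2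
  exact h2

lemma norm_localOp_le (H : Matrix (A × B) (A × B) ℂ) (ψ : StateSpace a A B b) :
    ‖localOp a b H ψ‖ ≤ opNorm H * ‖ψ‖ := by
  have h0 : 0 ≤ opNorm H := norm_nonneg _
  refine le_of_sq_le_sq ?_ (by positivity)
  rw [mul_pow, EuclideanSpace.norm_sq_eq, EuclideanSpace.norm_sq_eq]
  simp only [Fintype.sum_prod_type (α₁ := a), Fintype.sum_prod_type_right (α₂ := b),
    localOp_apply, Finset.mul_sum (s := (Finset.univ : Finset a)),
    Finset.mul_sum (s := (Finset.univ : Finset b))]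
  exact Finset.sum_le_sum fun i _ => Finset.sum_le_sum fun k _ =>
    sum_norm_sq_mulVec_le H fun z => ψ (i, z, k)

/-- The product vector `u ⊗ v` of a vector of `aA` and a vector of `Bb`. -/
def tensor (u : EuclideanSpace ℂ (a × A)) (v : EuclideanSpace ℂ (B × b)) : StateSpace a A B b :=
  WithLp.toLp 2 fun s => u (s.1, s.2.1.1) * v (s.2.1.2, s.2.2)

omit [DecidableEq a] [DecidableEq A] [DecidableEq B] [DecidableEq b] in
lemma inner_tensor (u u' : EuclideanSpace ℂ (a × A)) (v v' : EuclideanSpace ℂ (B × b)) :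
    inner ℂ (tensor u v) (tensor u' v') = inner ℂ u u' * inner ℂ v v' := by
  simp only [tensor, PiLp.inner_apply, RCLike.inner_apply, map_mul]
  rw [Fintype.sum_mul_sum, ← Fintype.sum_prod_type']
  refine Fintype.sum_equiv
    ⟨fun s => ((s.1, s.2.1.1), (s.2.1.2, s.2.2)), fun s => (s.1.1, (s.1.2, s.2.1), s.2.2),
      fun _ => rfl, fun _ => rfl⟩ _ _ fun s => ?_
  simp only [Equiv.coe_fn_mk]
  ring

lemma inner_tensor_localOp (H : Matrix (A × B) (A × B) ℂ) (f u : EuclideanSpace ℂ (a × A))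
    (g v : EuclideanSpace ℂ (B × b)) :
    inner ℂ (tensor f g) (localOp a b H (tensor u v)) =
      ∑ y, ∑ y', ∑ x, ∑ x', ∑ i, ∑ k,
        star (f (i, x)) * star (g (y, k)) * H (x, y) (x', y') * u (i, x') * v (y', k) := by
  simp only [PiLp.inner_apply, RCLike.inner_apply, Fintype.sum_prod_type, localOp_apply,
    Finset.sum_mul]
  simp only [← Fintype.sum_prod_type']
  refine Fintype.sum_equiv
    ⟨fun (i, x, y, k, x', y') => (y, y', x, x', i, k),
      fun (y, y', x, x', i, k) => (i, x, y, k, x', y'), fun _ => rfl, fun _ => rfl⟩ _ _ fun s => ?_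
  simp only [Equiv.coe_fn_mk, tensor, map_mul, starRingEnd_apply]
  ring

/-- `⟨f ⊗ g, H (u ⊗ v)⟩` as a sum over pairs `s` of basis vectors of `B`, obtained by splitting
`H = ∑ s, X s ⊗ |s.1⟩⟨s.2|`; here `F s` is `(X s)† f` and `G s` is `|s.2⟩⟨s.1| g`. -/
lemma exists_decomposition_right {H : Matrix (A × B) (A × B) ℂ} (hH : H.IsHermitian)
    (f : EuclideanSpace ℂ (a × A)) (g : EuclideanSpace ℂ (B × b)) :
    ∃ (F : B × B → EuclideanSpace ℂ (a × A)) (G : B × B → EuclideanSpace ℂ (B × b)),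
      (∀ u v, inner ℂ (tensor f g) (localOp a b H (tensor u v)) =
        ∑ s, inner ℂ (F s) u * inner ℂ (G s) v) ∧
      (∀ s, ‖F s‖ ≤ opNorm H * ‖f‖) ∧ (∀ s, ‖G s‖ ≤ ‖g‖) ∧
      (Fintype.card B = 1 → ∀ s, G s = g) := by
  refine ⟨fun s => WithLp.toLp 2 fun p => ∑ x, H (p.2, s.2) (x, s.1) * f (p.1, x),
    fun s => WithLp.toLp 2 fun q => if q.1 = s.2 then g (s.1, q.2) else 0, ?_, ?_, ?_, ?_⟩
  · intro u v
    rw [inner_tensor_localOp, Fintype.sum_prod_type]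
    refine Finset.sum_congr rfl fun y _ => Finset.sum_congr rfl fun y' _ => ?_
    have hG : inner ℂ (WithLp.toLp 2 fun q : B × b => if q.1 = y' then g (y, q.2) else 0) v =
        ∑ k, v (y', k) * star (g (y, k)) := by
      simp only [PiLp.inner_apply, RCLike.inner_apply]
      rw [Fintype.sum_prod_type, Finset.sum_eq_single y' (fun y _ h => by simp [h]) (by simp)]
      simp
    rw [hG]
    simp only [PiLp.inner_apply, RCLike.inner_apply, Fintype.sum_prod_type, map_sum, map_mul,
      starRingEnd_apply, hH.apply]
    simp only [Finset.mul_sum, Finset.sum_mul]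
    simp only [← Fintype.sum_prod_type']
    refine Fintype.sum_equiv
      ⟨fun (x, x', i, k) => (k, i, x', x), fun (k, i, x', x) => (x, x', i, k),
        fun _ => rfl, fun _ => rfl⟩ _ _ fun s => ?_
    simp only [Equiv.coe_fn_mk]
    ring
  · intro s
    -- `F s` is a part of the image of `f ⊗ |s.1⟩` under `1 ⊗ H`.
    let φ : StateSpace a A B Unit := tensor f
      (WithLp.toLp 2 fun q : B × Unit => if q.1 = s.1 then 1 else 0)
    have hφ : ‖φ‖ ^ 2 = ‖f‖ ^ 2 := by
      simp only [φ, tensor, EuclideanSpace.norm_sq_eq, Fintype.sum_prod_type]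
      simp [apply_ite]
    have hF := (norm_localOp_le H φ).trans_eq
      (by rw [(sq_eq_sq₀ (norm_nonneg _) (norm_nonneg _)).1 hφ])
    refine le_trans (le_of_sq_le_sq ?_ (norm_nonneg _)) hF
    rw [EuclideanSpace.norm_sq_eq, EuclideanSpace.norm_sq_eq]
    simp only [Fintype.sum_prod_type, localOp_apply, φ, tensor]
    refine Finset.sum_le_sum fun i _ => Finset.sum_le_sum fun x _ => ?_
    refine le_trans (le_of_eq ?_) (Finset.single_le_sum
      (fun y _ => by positivity) (Finset.mem_univ s.2))
    simp
  · intro s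
    refine le_of_sq_le_sq ?_ (norm_nonneg _)
    rw [EuclideanSpace.norm_sq_eq, EuclideanSpace.norm_sq_eq, Fintype.sum_prod_type,
      Fintype.sum_prod_type, Finset.sum_eq_single s.2 (fun y _ h => by simp [h]) (by simp)]
    simpa using Finset.single_le_sum (f := fun y => ∑ k, ‖g (y, k)‖ ^ 2)
      (fun y _ => by positivity) (Finset.mem_univ s.1)
  · intro hB s
    have : Subsingleton B := Fintype.card_le_one_iff_subsingleton.1 hB.le
    ext q
    have h : (s.1, q.2) = q := Prod.ext (Subsingleton.elim _ _) rfl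
    simp [Subsingleton.elim q.1 s.2, h]

/-- The counterpart of `exists_decomposition_right` for `H = ∑ s, |s.1⟩⟨s.2| ⊗ Y s`, with `s`
ranging over the pairs of basis vectors of `A`. -/
lemma exists_decomposition_left {H : Matrix (A × B) (A × B) ℂ} (hH : H.IsHermitian)
    (f : EuclideanSpace ℂ (a × A)) (g : EuclideanSpace ℂ (B × b)) :
    ∃ (F : A × A → EuclideanSpace ℂ (a × A)) (G : A × A → EuclideanSpace ℂ (B × b)),
      (∀ u v, inner ℂ (tensor f g) (localOp a b H (tensor u v)) =
        ∑ s, inner ℂ (F s) u * inner ℂ (G s) v) ∧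
      (∀ s, ‖F s‖ ≤ ‖f‖) ∧ (∀ s, ‖G s‖ ≤ opNorm H * ‖g‖) ∧
      (Fintype.card A = 1 → ∀ s, F s = f) := by
  refine ⟨fun s => WithLp.toLp 2 fun p => if p.2 = s.2 then f (p.1, s.1) else 0,
    fun s => WithLp.toLp 2 fun q => ∑ y, H (s.2, q.1) (s.1, y) * g (y, q.2), ?_, ?_, ?_, ?_⟩
  · intro u v
    rw [inner_tensor_localOp, Fintype.sum_prod_type]
    have hF : ∀ x x', inner ℂ
        (WithLp.toLp 2 fun p : a × A => if p.2 = x' then f (p.1, x) else 0) u =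
        ∑ i, u (i, x') * star (f (i, x)) := by
      intro x x'
      simp only [PiLp.inner_apply, RCLike.inner_apply]
      rw [Fintype.sum_prod_type_right, Finset.sum_eq_single x' (fun y _ h => by simp [h]) (by simp)]
      simp
    simp only [hF]
    simp only [PiLp.inner_apply, RCLike.inner_apply, Fintype.sum_prod_type, map_sum, map_mul,
      starRingEnd_apply, hH.apply]
    simp only [Finset.mul_sum, Finset.sum_mul]
    simp only [← Fintype.sum_prod_type']
    refine Fintype.sum_equiv
      ⟨fun (y, y', x, x', i, k) => (x, x', y', k, y, i),
        fun (x, x', y', k, y, i) => (y, y', x, x', i, k),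
        fun _ => rfl, fun _ => rfl⟩ _ _ fun s => ?_
    simp only [Equiv.coe_fn_mk]
    ring
  · intro s
    refine le_of_sq_le_sq ?_ (norm_nonneg _)
    rw [EuclideanSpace.norm_sq_eq, EuclideanSpace.norm_sq_eq, Fintype.sum_prod_type_right,
      Fintype.sum_prod_type_right, Finset.sum_eq_single s.2 (fun y _ h => by simp [h]) (by simp)]
    simpa using Finset.single_le_sum (f := fun x => ∑ i, ‖f (i, x)‖ ^ 2)
      (fun x _ => by positivity) (Finset.mem_univ s.1)
  · intro s
    -- `G s` is a part of the image of `|s.1⟩ ⊗ g` under `H ⊗ 1`.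
    let φ : StateSpace Unit A B b := tensor
      (WithLp.toLp 2 fun p : Unit × A => if p.2 = s.1 then 1 else 0) g
    have hφ : ‖φ‖ ^ 2 = ‖g‖ ^ 2 := by
      simp only [φ, tensor, EuclideanSpace.norm_sq_eq, Fintype.sum_prod_type]
      simp [apply_ite]
    have hG := (norm_localOp_le H φ).trans_eq
      (by rw [(sq_eq_sq₀ (norm_nonneg _) (norm_nonneg _)).1 hφ])
    refine le_trans (le_of_sq_le_sq ?_ (norm_nonneg _)) hG
    rw [EuclideanSpace.norm_sq_eq, EuclideanSpace.norm_sq_eq]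
    simp only [Fintype.sum_prod_type, localOp_apply, φ, tensor, Fintype.sum_unique]
    refine le_trans (le_of_eq ?_) (Finset.single_le_sum
      (fun x _ => by positivity) (Finset.mem_univ s.2))
    simp
  · intro hA s
    have : Subsingleton A := Fintype.card_le_one_iff_subsingleton.1 hA.le
    ext p
    have h : (p.1, s.1) = p := Prod.ext rfl (Subsingleton.elim _ _)
    simp [Subsingleton.elim p.2 s.2, h]

/-- A consequence of Bessel's inequality in both factors. -/
lemma norm_sum_inner_mul_inner_le {E F ι : Type*} [NormedAddCommGroup E] [InnerProductSpace ℂ E]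
    [NormedAddCommGroup F] [InnerProductSpace ℂ F] {u : ι → E} {v : ι → F}
    (hu : Orthonormal ℂ u) (hv : Orthonormal ℂ v) (s : Finset ι) (f : E) (g : F) :
    ‖∑ k ∈ s, inner ℂ f (u k) * inner ℂ g (v k)‖ ≤ ‖f‖ * ‖g‖ := by
  refine (norm_sum_le _ _).trans (le_of_sq_le_sq ?_ (by positivity))
  simp only [norm_mul]
  refine (Finset.sum_mul_sq_le_sq_mul_sq _ _ _).trans ?_
  rw [mul_pow]
  simp only [norm_inner_symm f, norm_inner_symm g]
  exact mul_le_mul (hu.sum_inner_products_le f) (hv.sum_inner_products_le g)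
    (by positivity) (by positivity)

section Orthonormal

variable {ι : Type*} {u : ι → EuclideanSpace ℂ (a × A)} {v : ι → EuclideanSpace ℂ (B × b)}

omit [DecidableEq a] [DecidableEq A] [DecidableEq B] [DecidableEq b] in
lemma norm_sum_inner_le_of_decomposition {σ : Type*} [Fintype σ] {N : ℝ} (hu : Orthonormal ℂ u)
    (hv : Orthonormal ℂ v) {T : EuclideanSpace ℂ (a × A) → EuclideanSpace ℂ (B × b) → ℂ}
    {F : σ → EuclideanSpace ℂ (a × A)} {G : σ → EuclideanSpace ℂ (B × b)}
    (hT : ∀ u v, T u v = ∑ s, inner ℂ (F s) u * inner ℂ (G s) v)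
    (hFG : ∀ s, ‖F s‖ * ‖G s‖ ≤ N) (s : Finset ι) :
    ‖∑ k ∈ s, T (u k) (v k)‖ ≤ Fintype.card σ * N := by
  simp only [hT]
  rw [Finset.sum_comm, ← nsmul_eq_mul]
  exact (norm_sum_le _ _).trans (Finset.sum_le_card_nsmul _ _ _ fun r _ =>
    (norm_sum_inner_mul_inner_le hu hv s _ _).trans (hFG r))

/-- The key estimate: the bound is independent of the number of terms, hence of the ancillas. -/
lemma norm_sum_inner_tensor_localOp_le {H : Matrix (A × B) (A × B) ℂ} (hH : H.IsHermitian)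
    (hu : Orthonormal ℂ u) (hv : Orthonormal ℂ v) (j : ι) (s : Finset ι) :
    ‖∑ k ∈ s, inner ℂ (tensor (u j) (v j)) (localOp a b H (tensor (u k) (v k)))‖ ≤
      (min (Fintype.card A) (Fintype.card B) : ℕ) ^ 2 * opNorm H := by
  have h0 : 0 ≤ opNorm H := norm_nonneg _
  rcases le_total (Fintype.card A) (Fintype.card B) with hAB | hAB
  · obtain ⟨F, G, h, hF, hG, -⟩ := exists_decomposition_left hH (u j) (v j)
    simp only [hu.1, hv.1, mul_one] at hF hG
    have := norm_sum_inner_le_of_decomposition hu hv h (N := opNorm H) (fun s =>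
      (mul_le_mul (hF s) (hG s) (norm_nonneg _) zero_le_one).trans_eq (one_mul _)) s
    rw [min_eq_left hAB]
    simpa [sq] using this
  · obtain ⟨F, G, h, hF, hG, -⟩ := exists_decomposition_right hH (u j) (v j)
    simp only [hu.1, hv.1, mul_one] at hF hG
    have := norm_sum_inner_le_of_decomposition hu hv h (N := opNorm H) (fun s =>
      (mul_le_mul (hF s) (hG s) (norm_nonneg _) h0).trans_eq (mul_one _)) s
    rw [min_eq_right hAB]
    simpa [sq] using this

/-- If `A` or `B` is one-dimensional, `H` acts on one side of the partition only. -/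
lemma inner_tensor_localOp_eq_zero {H : Matrix (A × B) (A × B) ℂ} (hH : H.IsHermitian)
    (hu : Orthonormal ℂ u) (hv : Orthonormal ℂ v)
    (hd : min (Fintype.card A) (Fintype.card B) = 1) {j k : ι} (hjk : j ≠ k) :
    inner ℂ (tensor (u j) (v j)) (localOp a b H (tensor (u k) (v k))) = 0 := by
  rcases min_choice (Fintype.card A) (Fintype.card B) with h | h
  · obtain ⟨F, G, h', -, -, hF⟩ := exists_decomposition_left hH (u j) (v j)
    rw [h', Finset.sum_eq_zero]
    intro s _
    rw [hF (h ▸ hd), hu.2 hjk, zero_mul]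
  · obtain ⟨F, G, h', -, -, hG⟩ := exists_decomposition_right hH (u j) (v j)
    rw [h', Finset.sum_eq_zero]
    intro s _
    rw [hG (h ▸ hd), hv.2 hjk, mul_zero]

omit [DecidableEq a] [DecidableEq A] [DecidableEq B] [DecidableEq b] in
lemma orthonormal_tensor (hu : Orthonormal ℂ u) (hv : Orthonormal ℂ v) :
    Orthonormal ℂ fun j => tensor (u j) (v j) := by
  classical
  rw [orthonormal_iff_ite] at *
  intro i j
  rw [inner_tensor, hu, hv]
  split_ifs <;> simp

end Orthonormal

/-! ### The numerical estimate -/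

/-- Two bounds on `x`, one of them decaying like `√(Q / P)`, control `log (P / Q) * x` uniformly in
`P / Q`. The case distinction is at `P / Q = d ^ 8`. -/
lemma log_sub_log_mul_le {d : ℕ} (hd : 2 ≤ d) {P Q N x : ℝ} (hQ : 0 < Q) (hQP : Q ≤ P) (hN : 0 ≤ N)
    (h1 : x ≤ N) (h2 : x ≤ (d : ℝ) ^ 2 * N * Real.sqrt (Q / P)) :
    2 * (Real.log P - Real.log Q) * x ≤ 24 * N * Real.log d := by
  have hP := hQ.trans_le hQP
  have hd' : (2 : ℝ) ≤ d := by exact_mod_cast hd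
  have hlogd : Real.log 2 ≤ Real.log d := Real.log_le_log two_pos hd'
  have hlog2 : (1 / 2 : ℝ) < Real.log 2 := by linarith [Real.log_two_gt_d9]
  rw [← Real.log_div hP.ne' hQ.ne']
  have hr : 1 ≤ P / Q := (one_le_div hQ).2 hQP
  rw [← inv_div P Q] at h2
  generalize P / Q = r at hr h2
  have hr0 : 0 < r := by linarith
  have hlogr : 0 ≤ Real.log r := Real.log_nonneg hr
  by_cases hc : r ≤ (d : ℝ) ^ 8
  · have : Real.log r ≤ 8 * Real.log d := by
      have := Real.log_le_log hr0 hc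
      rwa [Real.log_pow] at this
    nlinarith [mul_le_mul_of_nonneg_left h1 hlogr, mul_le_mul_of_nonneg_right this hN,
      mul_nonneg hN (by linarith : (0:ℝ) ≤ Real.log d)]
  · -- Write `r = q ^ 4`; then `d ^ 2 ≤ q` and `log r = 4 log q ≤ 4 q`.
    push Not at hc
    obtain ⟨q, hq0, rfl⟩ : ∃ q : ℝ, 0 < q ∧ r = q ^ 4 :=
      ⟨r ^ (1 / 4 : ℝ), by positivity, by
        rw [← Real.rpow_natCast, ← Real.rpow_mul hr0.le]; norm_num⟩
    have hdq : (d : ℝ) ^ 2 ≤ q := by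
      have : ((d : ℝ) ^ 2) ^ 4 ≤ q ^ 4 := by rw [← pow_mul]; exact hc.le
      exact (pow_le_pow_iff_left₀ (by positivity) hq0.le (by norm_num)).1 this
    have hs : Real.sqrt (q ^ 4)⁻¹ = (q ^ 2)⁻¹ := by
      rw [show (q ^ 4)⁻¹ = ((q ^ 2)⁻¹) ^ 2 by field_simp, Real.sqrt_sq (by positivity)]
    have hlq : Real.log (q ^ 4) ≤ 4 * q := by
      rw [Real.log_pow]
      have := Real.log_le_sub_one_of_pos hq0
      push_cast
      linarith
    rw [hs] at h2
    have h3 : x ≤ N * q⁻¹ := by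
      refine h2.trans ?_
      calc (d : ℝ) ^ 2 * N * (q ^ 2)⁻¹ ≤ q * N * (q ^ 2)⁻¹ := by gcongr
        _ = N * q⁻¹ := by field_simp
    calc 2 * Real.log (q ^ 4) * x ≤ 2 * Real.log (q ^ 4) * (N * q⁻¹) := by gcongr
      _ ≤ 2 * (4 * q) * (N * q⁻¹) := by gcongr
      _ = 8 * N := by field_simp; ring
      _ ≤ 24 * N * Real.log d := by nlinarith

/-! ### The reduced state and its entropy at time zero -/

/-- The coefficients of a state vector as a matrix, across the partition `aA | Bb`. -/
def coeffMatrix (ψ : StateSpace a A B b) : Matrix (a × A) (B × b) ℂ :=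
  Matrix.of fun p q => ψ (p.1, (p.2, q.1), q.2)

lemma reducedState_eq (Ψ : StateSpace a A B b) (H : Matrix (A × B) (A × B) ℂ) (t : ℝ) :
    reducedState Ψ H t =
      coeffMatrix (localOp a b (NormedSpace.exp ((Complex.I * (t : ℂ)) • H)) Ψ) *
        (coeffMatrix (localOp a b (NormedSpace.exp ((Complex.I * (t : ℂ)) • H)) Ψ))ᴴ := by
  have h : evolution a b H t * ketBra Ψ * (evolution a b H t)ᴴ =
      ketBra (localOp a b (NormedSpace.exp ((Complex.I * (t : ℂ)) • H)) Ψ) := by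
    have hk : ∀ ψ : StateSpace a A B b, ketBra ψ = Matrix.vecMulVec ψ (star ψ) := fun _ => rfl
    rw [hk, hk, Matrix.mul_vecMulVec, Matrix.vecMulVec_mul, ← Matrix.star_mulVec]
    rfl
  rw [reducedState, h]
  ext p q
  simp [partialTraceBb, coeffMatrix, ketBra, Matrix.mul_apply, Fintype.sum_prod_type]

omit [Fintype a] [Fintype b] [DecidableEq a] [DecidableEq b] in
lemma hasDerivAt_exp_apply (H : Matrix (A × B) (A × B) ℂ) (z z' : A × B) :
    HasDerivAt (fun t : ℝ => NormedSpace.exp ((Complex.I * (t : ℂ)) • H) z z')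
      (Complex.I * H z z') 0 := by
  -- Any submultiplicative norm will do; this one induces the entrywise topology.
  let _ : NormedRing (Matrix (A × B) (A × B) ℂ) := Matrix.linftyOpNormedRing
  let _ : NormedAlgebra ℝ (Matrix (A × B) (A × B) ℂ) := Matrix.linftyOpNormedAlgebra
  let _ : NormedAlgebra ℂ (Matrix (A × B) (A × B) ℂ) := Matrix.linftyOpNormedAlgebra
  have h := hasDerivAt_exp_smul_const (𝕂 := ℝ) (Complex.I • H) (0 : ℝ)
  have h2 := ((Matrix.entryLinearMap ℝ ℂ z z').toContinuousLinearMap).hasFDerivAt.comp_hasDerivAt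
    (0 : ℝ) h
  refine (h2.congr_deriv ?_).congr_of_eventuallyEq (Filter.Eventually.of_forall fun t => ?_)
  · simp
    rfl
  · simp [← Complex.coe_smul, smul_smul, mul_comm]
    rfl

lemma hasDerivAt_coeffMatrix (Ψ : StateSpace a A B b) (H : Matrix (A × B) (A × B) ℂ)
    (p : a × A) (q : B × b) :
    HasDerivAt (fun t : ℝ =>
        coeffMatrix (localOp a b (NormedSpace.exp ((Complex.I * (t : ℂ)) • H)) Ψ) p q)
      (coeffMatrix (Complex.I • localOp a b H Ψ) p q) 0 := by
  have h : HasDerivAt (fun t : ℝ => ∑ z, NormedSpace.exp ((Complex.I * (t : ℂ)) • H)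
      (p.2, q.1) z * Ψ (p.1, z, q.2)) (∑ z, (Complex.I * H (p.2, q.1) z) * Ψ (p.1, z, q.2)) 0 :=
    HasDerivAt.fun_sum fun z _ => (hasDerivAt_exp_apply H (p.2, q.1) z).mul_const _
  simpa [coeffMatrix, localOp_apply, Finset.mul_sum, mul_assoc] using h

omit [DecidableEq B] [DecidableEq b] in
/-- The complex conjugate of `v` appears because `coeffMatrix` reads a vector of `Bb` as a column
index, without conjugation. -/
lemma inner_coeffMatrix (ψ : StateSpace a A B b) (u : EuclideanSpace ℂ (a × A))
    (v : EuclideanSpace ℂ (B × b)) :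
    inner ℂ (WithLp.toLp 2 (star v.ofLp) : EuclideanSpace ℂ (B × b))
      ((coeffMatrix ψ)ᴴ.toEuclideanLin u) = inner ℂ ψ (tensor u v) := by
  simp only [PiLp.inner_apply, RCLike.inner_apply, tensor, Matrix.ofLp_toLpLin, Matrix.toLin'_apply,
    Matrix.mulVec, dotProduct, Finset.sum_mul, Pi.star_apply, coeffMatrix,
    Matrix.conjTranspose_apply, Matrix.of_apply, starRingEnd_apply, star_star]
  rw [Finset.sum_comm, ← Fintype.sum_prod_type']
  refine Fintype.sum_equiv
    ⟨fun s => (s.1.1, (s.1.2, s.2.1), s.2.2), fun s => ((s.1, s.2.1.1), (s.2.1.2, s.2.2)),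
      fun _ => rfl, fun _ => rfl⟩ _ _ fun s => ?_
  simp only [Equiv.coe_fn_mk]
  ring

section Schmidt

variable {Ψ : StateSpace a A B b} {r : ℕ} {p : Fin r → ℝ}
  {u : Fin r → EuclideanSpace ℂ (a × A)} {v : Fin r → EuclideanSpace ℂ (B × b)}

omit [DecidableEq a] [DecidableEq A] [DecidableEq B] [DecidableEq b] in
lemma IsSchmidtDecomposition.eq_sum (h : IsSchmidtDecomposition Ψ p u v) :
    Ψ = ∑ j, (Real.sqrt (p j) : ℂ) • tensor (u j) (v j) := by
  ext ⟨i, ⟨x, y⟩, k⟩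
  rw [h.decomposition]
  simp [tensor]

omit [DecidableEq B] [DecidableEq b] in
lemma IsSchmidtDecomposition.conjTranspose_apply (h : IsSchmidtDecomposition Ψ p u v)
    (e : EuclideanSpace ℂ (a × A)) :
    (coeffMatrix Ψ)ᴴ.toEuclideanLin e =
      ∑ j, ((Real.sqrt (p j) : ℂ) * inner ℂ (u j) e) • WithLp.toLp 2 (star (v j).ofLp) := by
  refine ext_inner_left ℂ fun w => ?_
  obtain ⟨w, rfl⟩ : ∃ w' : EuclideanSpace ℂ (B × b), WithLp.toLp 2 (star w'.ofLp) = w :=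
    ⟨WithLp.toLp 2 (star w.ofLp), by ext; simp⟩
  rw [inner_coeffMatrix, h.eq_sum, sum_inner, inner_sum]
  refine Finset.sum_congr rfl fun j _ => ?_
  have : inner ℂ (WithLp.toLp 2 (star w.ofLp)) (WithLp.toLp 2 (star (v j).ofLp)) =
      inner ℂ (v j) w := by
    simp [PiLp.inner_apply, mul_comm]
  rw [inner_smul_left, inner_smul_right, inner_tensor, this, Complex.conj_ofReal, mul_assoc]

lemma IsSchmidtDecomposition.apply_conj (h : IsSchmidtDecomposition Ψ p u v) (j : Fin r) :
    (coeffMatrix Ψ).toEuclideanLin (WithLp.toLp 2 (star (v j).ofLp)) =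
      (Real.sqrt (p j) : ℂ) • u j := by
  refine ext_inner_right ℂ fun e => ?_
  have := LinearMap.adjoint_inner_right (coeffMatrix Ψ).toEuclideanLin
    (WithLp.toLp 2 (star (v j).ofLp)) e
  rw [← this, ← Matrix.toEuclideanLin_conjTranspose_eq_adjoint, inner_coeffMatrix, h.eq_sum,
    sum_inner, Finset.sum_eq_single j]
  · rw [inner_smul_left, inner_smul_left, inner_tensor, inner_self_eq_norm_sq_to_K,
      h.right_orthonormal.1]
    simp
  · intro k _ hk
    rw [inner_smul_left, inner_tensor, h.right_orthonormal.2 hk]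
    simp
  · simp

/-- The entropy is differentiable at zero, with the derivative that first-order perturbation theory
of the eigenvalues `p j` suggests. -/
lemma IsSchmidtDecomposition.hasDerivAt_entanglementEntropy (h : IsSchmidtDecomposition Ψ p u v)
    (H : Matrix (A × B) (A × B) ℂ) :
    HasDerivAt (entanglementEntropy Ψ H)
      ((∑ j, (1 + Real.log (p j)) * (2 * (inner ℂ ((Real.sqrt (p j) : ℂ) • tensor (u j) (v j))
        (localOp a b H Ψ)).im)) / Real.log 2) 0 := by
  have hS : entanglementEntropy Ψ H = fun t => vonNeumannEntropy (_ * _ᴴ) :=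
    funext fun t => congrArg vonNeumannEntropy (reducedState_eq Ψ H t)
  have h0 : coeffMatrix (localOp a b (NormedSpace.exp ((Complex.I * ((0 : ℝ) : ℂ)) • H)) Ψ) =
      coeffMatrix Ψ := by
    simp [localOp]
  obtain ⟨w, e, hw, he⟩ := h.left_orthonormal.toSubtypeRange.exists_orthonormalBasis_extension
  have hinj := h.left_orthonormal.linearIndependent.injective
  have hker : ∀ i : w, (i : EuclideanSpace ℂ (a × A)) ∉ Set.range u →
      (coeffMatrix Ψ)ᴴ.toEuclideanLin (e i) = 0 := by
    intro i hi
    rw [h.conjTranspose_apply, Finset.sum_eq_zero]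
    intro j _
    have hj : u j ∈ w := hw ⟨j, rfl⟩
    have : inner ℂ (e ⟨u j, hj⟩) (e i) = 0 := e.orthonormal.2 fun hij => hi ⟨j, by rw [← hij]⟩
    rw [he] at this ⊢
    rw [this]
    simp
  have hran : ∀ j, (coeffMatrix Ψ)ᴴ.toEuclideanLin (u j) =
      (Real.sqrt (p j) : ℂ) • WithLp.toLp 2 (star (v j).ofLp) := by
    intro j
    rw [h.conjTranspose_apply, Finset.sum_eq_single j]
    · rw [inner_self_eq_norm_sq_to_K, h.left_orthonormal.1]
      simp
    · intro k _ hk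
      rw [h.left_orthonormal.2 hk]
      simp
    · simp
  -- `l i` is the eigenvalue of the reduced state at the basis vector `i`.
  let l : w → ℝ := fun i => if hi : (i : EuclideanSpace ℂ (a × A)) ∈ Set.range u
    then p hi.choose else 0
  have hl : ∀ (j : Fin r) (hj : u j ∈ w), l ⟨u j, hj⟩ = p j := by
    intro j hj
    have hi : u j ∈ Set.range u := ⟨j, rfl⟩
    simp only [l, dif_pos hi]
    rw [hinj hi.choose_spec]
  have hD := hasDerivAt_vonNeumannEntropy (hasDerivAt_coeffMatrix Ψ H) e l
    (fun i => by
      simp only [l]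
      split_ifs with hi
      exacts [(h.pos _).le, le_rfl])
    (fun i => by
      rw [h0, toEuclideanLin_mul_conjTranspose]
      by_cases hi : (i : EuclideanSpace ℂ (a × A)) ∈ Set.range u
      · obtain ⟨i, hi'⟩ := i
        obtain ⟨j, rfl⟩ := hi
        rw [hl, he]
        simp only
        rw [hran, map_smul, h.apply_conj, smul_smul, ← Complex.ofReal_mul,
          Real.mul_self_sqrt (h.pos j).le]
      · rw [hker i hi]
        simp only [l, dif_neg hi]
        simp)
  rw [hS]
  refine hD.congr_deriv ?_
  rw [h0, ← Finset.sum_neg_distrib]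
  congr 1
  symm
  refine Finset.sum_of_injOn (fun j => (⟨u j, hw ⟨j, rfl⟩⟩ : w))
    (fun j _ k _ hjk => hinj (congrArg Subtype.val hjk)) (by simp) ?_ ?_
  · intro i _ hi
    rw [hker i fun ⟨j, hj⟩ => hi ⟨j, by simp, Subtype.ext hj⟩]
    simp
  · intro j _
    rw [hl, he]
    simp only
    have hj : inner ℂ ((Real.sqrt (p j) : ℂ) • WithLp.toLp 2 (star (v j).ofLp))
        ((coeffMatrix (Complex.I • localOp a b H Ψ))ᴴ.toEuclideanLin (u j)) =
        Real.sqrt (p j) * (-Complex.I * inner ℂ (localOp a b H Ψ) (tensor (u j) (v j))) := by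
      rw [inner_smul_left, inner_coeffMatrix, inner_smul_left, Complex.conj_ofReal, Complex.conj_I]
    rw [hran, hj, inner_smul_left, Complex.conj_ofReal, ← inner_conj_symm (tensor (u j) (v j))]
    simp only [Complex.re_ofReal_mul, Complex.im_ofReal_mul, Complex.conj_im, neg_mul,
      Complex.neg_re, Complex.I_mul_re]
    ring

end Schmidt

/-! ### States with two Schmidt coefficients -/

lemma exists_two_values {r : ℕ} {p : Fin r → ℝ} (hp : ∀ j, 0 < p j)
    (h : (Set.range p).ncard ≤ 2) :
    ∃ P Q : ℝ, 0 < Q ∧ Q ≤ P ∧ ∀ j, p j = P ∨ p j = Q := by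
  rcases Nat.lt_or_ge (Set.range p).ncard 2 with h1 | h2
  · rcases isEmpty_or_nonempty (Fin r) with _ | ⟨⟨j₀⟩⟩
    · exact ⟨1, 1, one_pos, le_rfl, isEmptyElim⟩
    · exact ⟨p j₀, p j₀, hp _, le_rfl, fun j => Or.inl
        ((Set.ncard_le_one (Set.finite_range p)).1 (by omega) _ ⟨j, rfl⟩ _ ⟨j₀, rfl⟩)⟩
  · obtain ⟨x, y, -, hxy⟩ := Set.ncard_eq_two.1 (le_antisymm h h2)
    have hmem : ∀ j, p j = x ∨ p j = y := fun j => by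
      have : p j ∈ Set.range p := ⟨j, rfl⟩
      rwa [hxy] at this
    have hpos : ∀ z ∈ ({x, y} : Set ℝ), 0 < z := by
      rw [← hxy]; rintro _ ⟨j, rfl⟩; exact hp j
    rcases le_total y x with hle | hle
    · exact ⟨x, y, hpos y (by simp), hle, hmem⟩
    · exact ⟨y, x, hpos x (by simp), hle, fun j => (hmem j).symm⟩

section Schmidt

variable {Ψ : StateSpace a A B b} {r : ℕ} {p : Fin r → ℝ}
  {u : Fin r → EuclideanSpace ℂ (a × A)} {v : Fin r → EuclideanSpace ℂ (B × b)}

/-- The part of the Schmidt decomposition of a state that is carried by the indices in `s`. -/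
def schmidtPart (p : Fin r → ℝ) (u : Fin r → EuclideanSpace ℂ (a × A))
    (v : Fin r → EuclideanSpace ℂ (B × b)) (s : Finset (Fin r)) : StateSpace a A B b :=
  ∑ j ∈ s, (Real.sqrt (p j) : ℂ) • tensor (u j) (v j)

omit [DecidableEq a] [DecidableEq A] [DecidableEq B] [DecidableEq b] in
lemma IsSchmidtDecomposition.norm_schmidtPart_sq (h : IsSchmidtDecomposition Ψ p u v)
    (s : Finset (Fin r)) : ‖schmidtPart p u v s‖ ^ 2 = ∑ j ∈ s, p j := by
  have := (orthonormal_tensor h.left_orthonormal h.right_orthonormal).inner_sum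
    (fun j => (Real.sqrt (p j) : ℂ)) (fun j => (Real.sqrt (p j) : ℂ)) s
  have h2 := congrArg Complex.re this
  rw [schmidtPart, ← @inner_self_eq_norm_sq ℂ]
  refine h2.trans ?_
  rw [Complex.re_sum]
  refine Finset.sum_congr rfl fun j _ => ?_
  rw [Complex.conj_ofReal, ← Complex.ofReal_mul, Complex.ofReal_re,
    Real.mul_self_sqrt (h.pos j).le]

omit [DecidableEq a] [DecidableEq A] [DecidableEq B] [DecidableEq b] in
lemma IsSchmidtDecomposition.norm_schmidtPart_le (h : IsSchmidtDecomposition Ψ p u v)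
    (hΨ : ‖Ψ‖ = 1) (s : Finset (Fin r)) : ‖schmidtPart p u v s‖ ≤ 1 := by
  have h1 : ‖schmidtPart p u v Finset.univ‖ ^ 2 = 1 := by
    rw [schmidtPart, ← h.eq_sum, hΨ, one_pow]
  rw [← sq_le_one_iff₀ (norm_nonneg _), ← h1, h.norm_schmidtPart_sq, h.norm_schmidtPart_sq]
  exact Finset.sum_le_sum_of_subset_of_nonneg (Finset.subset_univ s) fun j _ _ => (h.pos j).le

lemma inner_schmidtPart_localOp (H : Matrix (A × B) (A × B) ℂ) (s s' : Finset (Fin r)) :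
    inner ℂ (schmidtPart p u v s) (localOp a b H (schmidtPart p u v s')) =
      ∑ j ∈ s, ∑ k ∈ s', (Real.sqrt (p j) : ℂ) * ((Real.sqrt (p k) : ℂ) *
        inner ℂ (tensor (u j) (v j)) (localOp a b H (tensor (u k) (v k)))) := by
  simp only [schmidtPart, map_sum, map_smul, sum_inner, inner_sum, inner_smul_left,
    inner_smul_right, Complex.conj_ofReal]
  simp only [Finset.mul_sum]
  rw [Finset.sum_comm]
  exact Finset.sum_congr rfl fun j _ => Finset.sum_congr rfl fun k _ => by ring

/-- There are at most `1 / P` indices `j` in `s`, as `Ψ` is a unit vector, and each contributes at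
most `√P * √Q` times the bound of `norm_sum_inner_tensor_localOp_le`. -/
lemma IsSchmidtDecomposition.norm_inner_schmidtPart_le (h : IsSchmidtDecomposition Ψ p u v)
    (hΨ : ‖Ψ‖ = 1) {H : Matrix (A × B) (A × B) ℂ} (hH : H.IsHermitian) {P Q : ℝ}
    (hQ : 0 < Q) (hQP : Q ≤ P) {s s' : Finset (Fin r)} (hs : ∀ j ∈ s, p j = P)
    (hs' : ∀ j ∈ s', p j = Q) :
    ‖inner ℂ (schmidtPart p u v s) (localOp a b H (schmidtPart p u v s'))‖ ≤
      (min (Fintype.card A) (Fintype.card B) : ℕ) ^ 2 * opNorm H * Real.sqrt (Q / P) := by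
  have hP := hQ.trans_le hQP
  set C : ℝ := (min (Fintype.card A) (Fintype.card B) : ℕ) ^ 2 * opNorm H with hC
  have hC0 : 0 ≤ C := mul_nonneg (by positivity) (norm_nonneg _)
  have hcard : s.card * P ≤ 1 := by
    have h1 := h.norm_schmidtPart_sq s
    rw [Finset.sum_congr rfl hs, Finset.sum_const, nsmul_eq_mul] at h1
    rw [← h1]
    exact pow_le_one₀ (norm_nonneg _) (h.norm_schmidtPart_le hΨ s)
  have hterm : ∀ j ∈ s, ‖∑ k ∈ s', (Real.sqrt (p j) : ℂ) * ((Real.sqrt (p k) : ℂ) *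
      inner ℂ (tensor (u j) (v j)) (localOp a b H (tensor (u k) (v k))))‖ ≤
      P * Real.sqrt (Q / P) * C := by
    intro j hj
    rw [Finset.sum_congr rfl fun k hk => by rw [hs j hj, hs' k hk], ← Finset.mul_sum,
      ← Finset.mul_sum, ← mul_assoc, norm_mul, norm_mul, Complex.norm_real, Complex.norm_real,
      Real.norm_of_nonneg (Real.sqrt_nonneg _), Real.norm_of_nonneg (Real.sqrt_nonneg _)]
    have hPQ : Real.sqrt P * Real.sqrt Q = P * Real.sqrt (Q / P) := by
      rw [Real.sqrt_div hQ.le, mul_div_assoc', eq_div_iff (Real.sqrt_pos.2 hP).ne',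
        mul_right_comm, Real.mul_self_sqrt hP.le]
    rw [hPQ]
    exact mul_le_mul_of_nonneg_left
      (norm_sum_inner_tensor_localOp_le hH h.left_orthonormal h.right_orthonormal j s')
      (by positivity)
  rw [inner_schmidtPart_localOp]
  refine (norm_sum_le _ _).trans ((Finset.sum_le_card_nsmul _ _ _ hterm).trans ?_)
  rw [nsmul_eq_mul]
  calc (s.card : ℝ) * (P * Real.sqrt (Q / P) * C) = (s.card * P) * (C * Real.sqrt (Q / P)) := by
        ring
    _ ≤ 1 * (C * Real.sqrt (Q / P)) := by gcongr
    _ = _ := one_mul _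

/-- With two Schmidt coefficients only the matrix element of `H` between the two parts of the state
enters the rate: the diagonal ones are real, and so is `⟨Ψ, H Ψ⟩`. -/
lemma IsSchmidtDecomposition.hasDerivAt_of_two_values (h : IsSchmidtDecomposition Ψ p u v)
    {H : Matrix (A × B) (A × B) ℂ} (hH : H.IsHermitian) {P Q : ℝ} {s : Finset (Fin r)}
    (hs : ∀ j ∈ s, p j = P) (hs' : ∀ j ∈ sᶜ, p j = Q) :
    HasDerivAt (entanglementEntropy Ψ H)
      (2 * (Real.log P - Real.log Q) * (inner ℂ (schmidtPart p u v s)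
        (localOp a b H (schmidtPart p u v sᶜ))).im / Real.log 2) 0 := by
  have hsym : ∀ ψ : StateSpace a A B b, (inner ℂ ψ (localOp a b H ψ)).im = 0 := fun ψ =>
    Complex.conj_eq_iff_im.1 (by rw [inner_conj_symm, localOp_isSymmetric hH])
  have hsum : Ψ = schmidtPart p u v s + schmidtPart p u v sᶜ := by
    conv_lhs => rw [h.eq_sum]
    exact (Finset.sum_add_sum_compl s _).symm
  refine (h.hasDerivAt_entanglementEntropy H).congr_deriv ?_
  have hpart : ∀ (s' : Finset (Fin r)) (R : ℝ), (∀ j ∈ s', p j = R) →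
      ∑ j ∈ s', (1 + Real.log (p j)) * (2 * (inner ℂ ((Real.sqrt (p j) : ℂ) • tensor (u j) (v j))
        (localOp a b H Ψ)).im) =
      (1 + Real.log R) * (2 * (inner ℂ (schmidtPart p u v s') (localOp a b H Ψ)).im) := by
    intro s' R hR
    rw [schmidtPart, sum_inner, Complex.im_sum, Finset.mul_sum, Finset.mul_sum]
    exact Finset.sum_congr rfl fun j hj => by rw [hR j hj]
  have h0 := hsym Ψ
  have h1 := hsym (schmidtPart p u v s)
  rw [← Finset.sum_add_sum_compl s, hpart s P hs, hpart sᶜ Q hs']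
  conv at h0 =>
    enter [1, 1, 2]
    rw [hsum]
  rw [inner_add_left, Complex.add_im] at h0
  have h2 : (inner ℂ (schmidtPart p u v s) (localOp a b H Ψ)).im =
      (inner ℂ (schmidtPart p u v s) (localOp a b H (schmidtPart p u v sᶜ))).im := by
    conv_lhs => rw [hsum, map_add, inner_add_right, Complex.add_im, h1, zero_add]
  rw [← h2, eq_neg_of_add_eq_zero_right h0]
  ring

end Schmidt

end Entangling

end

theorem mainTheorem1 {a A B b : Type*} [Fintype a] [Fintype A] [Fintype B] [Fintype b]
    [DecidableEq a] [DecidableEq A] [DecidableEq B] [DecidableEq b]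
    (H : Matrix (A × B) (A × B) ℂ) (hH : H.IsHermitian)
    (Ψ : Entangling.StateSpace a A B b) (hΨ : ‖Ψ‖ = 1)
    (hS : Entangling.AtMostTwoSchmidtCoefficients Ψ) :
    DifferentiableAt ℝ (Entangling.entanglementEntropy Ψ H) 0 ∧
      Entangling.entanglingRate Ψ H ≤
        24 * Entangling.opNorm H *
          Real.logb 2 (min (Fintype.card A) (Fintype.card B) : ℕ) := by
  obtain ⟨r, p, u, v, h, hp⟩ := hS
  obtain ⟨P, Q, hQ, hQP, hPQ⟩ := Entangling.exists_two_values h.pos hp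
  let s : Finset (Fin r) := Finset.univ.filter fun j => p j = P
  have hs : ∀ j ∈ s, p j = P := fun j hj => (Finset.mem_filter.1 hj).2
  have hs' : ∀ j ∈ sᶜ, p j = Q := fun j hj => (hPQ j).resolve_left fun hj' =>
    Finset.mem_compl.1 hj (Finset.mem_filter.2 ⟨Finset.mem_univ j, hj'⟩)
  have hD := h.hasDerivAt_of_two_values hH hs hs'
  refine ⟨hD.differentiableAt, ?_⟩
  rw [Entangling.entanglingRate, hD.deriv, Real.logb, mul_div_assoc']
  refine div_le_div_of_nonneg_right ?_ (Real.log_nonneg one_le_two)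
  have hN : 0 ≤ Entangling.opNorm H := norm_nonneg _
  obtain ⟨⟨-, ⟨x, y⟩, -⟩⟩ : Nonempty (a × (A × B) × b) := by
    by_contra hempty
    rw [not_nonempty_iff] at hempty
    simp [Subsingleton.elim Ψ 0] at hΨ
  have hd : 1 ≤ min (Fintype.card A) (Fintype.card B) :=
    le_min (Fintype.card_pos_iff.2 ⟨x⟩) (Fintype.card_pos_iff.2 ⟨y⟩)
  -- For `d = 1` the claim is that the rate vanishes.
  rcases hd.eq_or_lt with hd1 | hd2
  · rw [Entangling.inner_schmidtPart_localOp, Finset.sum_eq_zero]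
    · simp [← hd1]
    · intro j hj
      refine Finset.sum_eq_zero fun k hk => ?_
      rw [Entangling.inner_tensor_localOp_eq_zero hH h.left_orthonormal h.right_orthonormal
        hd1.symm (fun hjk : j = k => Finset.mem_compl.1 hk (hjk ▸ hj)), mul_zero, mul_zero]
  · refine Entangling.log_sub_log_mul_le hd2 hQ hQP hN ?_ ?_
    · refine (Complex.im_le_norm _).trans ((norm_inner_le_norm _ _).trans ?_)
      calc _ ≤ 1 * (Entangling.opNorm H * 1) := by
            refine mul_le_mul (h.norm_schmidtPart_le hΨ s) ?_ (norm_nonneg _) zero_le_one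
            exact (Entangling.norm_localOp_le H _).trans
              (mul_le_mul_of_nonneg_left (h.norm_schmidtPart_le hΨ _) hN)
        _ = _ := by ring
    · exact (Complex.im_le_norm _).trans (h.norm_inner_schmidtPart_le hΨ hH hQ hQP hs hs')
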